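/- Let $K$ be an algebraically closed field, let $n \ge 2$, and let $A = (A_1,\dots,A_n)$ be a tuple of $3\times 4$ matrices of rank $3$ with entries in $K$. Let $V_A \subseteq (\mathbb{P}^2)^n$ be the Zariski closure of the image of the rational map $\mathbb{P}^3 \dashrightarrow (\mathbb{P}^2)^n$, $q \mapsto (A_1 q, \dots, A_n q)$ (defined at the points $q$ that lie in the kernel of no $A_i$), and let $J_A$ be the ideal of all polynomials in $K[x,y,z] = K[x_i,y_i,z_i : 1\le i\le n]$ that vanish on $V_A$, where $(x_i:y_i:z_i)$ are the coordinates on the $i$-th factor $\mathbb{P}^2$. Put $p_i = (x_i,y_i,z_i)^T$. For $\sigma = \{\sigma_1 < \dots < \sigma_s\} \subseteq \{1,\dots,n\}$ let $A_\sigma$ be the $3s \times (s+4)$ matrix $$A_\sigma = \begin{bmatrix} A_{\sigma_1} & p_{\sigma_1} & 0 & \cdots & 0\\ A_{\sigma_2} & 0 & p_{\sigma_2} & \ddots & 0\\ \vdots & \vdots & \ddots & \ddots & \vdots\\ A_{\sigma_s} & 0 & \cdots & 0 & p_{\sigma_s}\end{bmatrix}.$$ Assume that $A$ is generic, i.e.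 that all $4\times 4$ minors of the $4 \times 3n$ matrix $[A_1^T \; A_2^T \; \cdots \; A_n^T]$ are non-zero. Then: 1. The maximal minors of the matrices $A_\sigma$ with $2 \le |\sigma| \le 4$ form a universal Gröbner basis of $J_A$: they are finitely many elements of $J_A$, and for every term order on $K[x,y,z]$ their leading terms generate the initial ideal of $J_A$. 2. Each maximal minor of $A_\sigma$ with $2 \le |\sigma| \le 4$ is multilinear of degree $|\sigma|$, so of degree $2$, $3$ or $4$: it is homogeneous of degree $|\sigma|$, homogeneous of degree $1$ in $(x_i,y_i,z_i)$ for every $i\in\sigma$, and does not involve $x_i,y_i,z_i$ for $i \notin\sigma$ (the zero polynomial, which occurs as a minor when $|\sigma| = 4$ and a whole block of three rows is left out, counts as homogeneous of every degree). 3. For the lexicographic term order with $x_1 \succ \dots \succ x_n \succ y_1 \succ \dots \succ y_n \succ z_1 \succ \dots \succ z_n$, the initial ideal of $J_A$ is the monomial ideal $$M_n = \langle\, x_i x_j,\; x_i y_j y_k,\; y_i y_j y_k y_l \;:\; i,j,k,l \in \{1,\dots,n\} \text{ distinct} \,\rangle$$ (each generator being taken for all choices of distinct values of the indices that occur in it).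 -/

import Mathlib

namespace Multiview

open MvPolynomial

open scoped Matrix LinearAlgebra.Projectivization

noncomputable section

/-! ### The polynomial ring `K[x, y, z]` in `3n` unknowns -/

/-- The `3n` unknowns. The pair `(0, i)` stands for `x_i`, `(1, i)` for `y_i` and `(2, i)` for `z_i`.
The index set carries the lexicographic order; under Mathlib's convention that a smaller index is
a larger variable, this is `x_1 ≻ ⋯ ≻ x_n ≻ y_1 ≻ ⋯ ≻ y_n ≻ z_1 ≻ ⋯ ≻ z_n`. -/
abbrev Var (n : ℕ) : Type := Fin 3 ×ₗ Fin n

/-- The coordinate `r` of the vector `p_i = (x_i, y_i, z_i)`, as a polynomial. -/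
def coord (K : Type*) [CommSemiring K] {n : ℕ} (r : Fin 3) (i : Fin n) : MvPolynomial (Var n) K :=
  X (toLex (r, i))

/-- The `ℤⁿ`-grading of `K[x, y, z]`: the unknowns `x_i, y_i, z_i` have degree `e_i`. -/
def multiWeight (n : ℕ) (v : Var n) : Fin n → ℕ := Pi.single (ofLex v).2 1

/-- `f` is multihomogeneous of multidegree `u`, i.e. homogeneous of degree `u i` in
`x_i, y_i, z_i` for every `i`. -/
def IsMultihomogeneous {K : Type*} [CommSemiring K] {n : ℕ} (u : Fin n → ℕ)
    (f : MvPolynomial (Var n) K) : Prop :=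
  IsWeightedHomogeneous (multiWeight n) f u

/-! ### Initial ideals and Gröbner bases -/

/-- The initial ideal of `I` for the term order `m`, generated by the leading terms of the
elements of `I`. -/
def initialIdeal {τ K : Type*} [Field K] (m : MonomialOrder τ) (I : Ideal (MvPolynomial τ K)) :
    Ideal (MvPolynomial τ K) :=
  Ideal.span (m.leadingTerm '' (I : Set (MvPolynomial τ K)))

/-- A Gröbner basis of `I` for the term order `m`: a finite subset of `I` whose leading terms
generate the initial ideal of `I`. (The element `0` has leading term `0`.) -/
structure IsGroebnerBasis {τ K : Type*} [Field K] (m : MonomialOrder τ)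
    (G : Set (MvPolynomial τ K)) (I : Ideal (MvPolynomial τ K)) : Prop where
  finite : G.Finite
  subset : G ⊆ (I : Set (MvPolynomial τ K))
  span_leadingTerm : Ideal.span (m.leadingTerm '' G) = initialIdeal m I

/-- A universal Gröbner basis: a Gröbner basis for all term orders. (Every term order is
isomorphic to one whose carrier lies in the universe of `τ`.) -/
def IsUniversalGroebnerBasis {τ : Type} {K : Type*} [Field K]
    (G : Set (MvPolynomial τ K)) (I : Ideal (MvPolynomial τ K)) : Prop :=
  ∀ m : MonomialOrder.{0, 0} τ, IsGroebnerBasis m G I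

/-! ### The multiview variety and its ideal -/

variable {K : Type*} [Field K] {n : ℕ}

/-- The value of `f` at the vectors `p_1, …, p_n ∈ K³`. -/
def evalAt (p : Fin n → Fin 3 → K) (f : MvPolynomial (Var n) K) : K :=
  eval (fun v => p (ofLex v).2 (ofLex v).1) f

/-- `f` vanishes at the point `P` of `(ℙ²)ⁿ`: it vanishes at all choices of homogeneous
coordinates of `P`. -/
def VanishesAt (f : MvPolynomial (Var n) K) (P : Fin n → ℙ K (Fin 3 → K)) : Prop :=
  ∀ (p : Fin n → Fin 3 → K) (hp : ∀ i, p i ≠ 0),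
    (∀ i, Projectivization.mk K (p i) (hp i) = P i) → evalAt p f = 0

/-- The Zariski closure of a subset `S` of `(ℙ²)ⁿ`: the points at which every multihomogeneous
polynomial that vanishes on `S` vanishes. -/
def zariskiClosure (S : Set (Fin n → ℙ K (Fin 3 → K))) : Set (Fin n → ℙ K (Fin 3 → K)) :=
  {P | ∀ (u : Fin n → ℕ) (f : MvPolynomial (Var n) K), IsMultihomogeneous u f →
    (∀ Q ∈ S, VanishesAt f Q) → VanishesAt f P}

/-- The rational map `ℙ³ ⇢ (ℙ²)ⁿ`, `q ↦ (A_1 q, …, A_n q)`, on its domain of definition, which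
consists of the points `q` that are in the kernel of no `A_i`. -/
def multiviewMap (A : Fin n → Matrix (Fin 3) (Fin 4) K)
    (q : {q : ℙ K (Fin 4 → K) // ∀ i, A i *ᵥ q.rep ≠ 0}) : Fin n → ℙ K (Fin 3 → K) :=
  fun i => Projectivization.mk K (A i *ᵥ q.1.rep) (q.2 i)

/-- The multiview variety `V_A`, the closure of the image of the map `multiviewMap A`. -/
def multiviewVariety (A : Fin n → Matrix (Fin 3) (Fin 4) K) : Set (Fin n → ℙ K (Fin 3 → K)) :=
  zariskiClosure (Set.range (multiviewMap A))

/-- The multiview ideal `J_A`: all polynomials that vanish on the multiview variety. -/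
def multiviewIdeal (A : Fin n → Matrix (Fin 3) (Fin 4) K) : Ideal (MvPolynomial (Var n) K) where
  carrier := {f | ∀ P ∈ multiviewVariety A, VanishesAt f P}
  add_mem' {f g} hf hg P hP p hp h := by
    have h1 := hf P hP p hp h
    have h2 := hg P hP p hp h
    unfold evalAt at *
    rw [map_add, h1, h2, add_zero]
  zero_mem' P hP p hp h := by
    unfold evalAt
    exact map_zero _
  smul_mem' c f hf P hP p hp h := by
    have h1 := hf P hP p hp h
    unfold evalAt at *
    rw [smul_eq_mul, map_mul, h1, mul_zero]

/-! ### Generic configurations and the minors -/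

/-- The `4 × 3n` matrix `[A_1ᵀ ⋯ A_nᵀ]`; the column `(i, r)` is the row `r` of `A_i`. -/
def transposeConcat (A : Fin n → Matrix (Fin 3) (Fin 4) K) : Matrix (Fin 4) (Fin n × Fin 3) K :=
  Matrix.of fun c p => A p.1 p.2 c

/-- `A` is generic: all `4 × 4` minors of `[A_1ᵀ ⋯ A_nᵀ]` are nonzero. -/
def IsGenericConfiguration (A : Fin n → Matrix (Fin 3) (Fin 4) K) : Prop :=
  ∀ e : Fin 4 ↪ Fin n × Fin 3, ((transposeConcat A).submatrix id e).det ≠ 0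

/-- The `3s × (s + 4)` matrix `A_σ`, `s = |σ|`. Its rows are indexed by the pairs `(i, r)` with
`i ∈ σ` in lexicographic order; its columns are four columns that hold the matrices `A_i`, followed
by one column for every `j ∈ σ`, which holds `p_j` in the block `j` and zeros elsewhere. -/
def cameraMatrix (A : Fin n → Matrix (Fin 3) (Fin 4) K) (σ : Finset (Fin n)) :
    Matrix (σ ×ₗ Fin 3) (Fin 4 ⊕ₗ σ) (MvPolynomial (Var n) K) :=
  Matrix.of fun p c => Sum.elim
    (fun c' : Fin 4 => C (A (ofLex p).1 (ofLex p).2 c'))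
    (fun j : σ => if (ofLex p).1 = j then coord K (ofLex p).2 (j : Fin n) else 0)
    (ofLex c)

/-- The maximal minors of `A_σ` (for `|σ| ≥ 2`, when there are at least as many rows as columns):
the determinants of the submatrices with all columns and with as many rows, in increasing order. -/
def maximalMinors (A : Fin n → Matrix (Fin 3) (Fin 4) K) (σ : Finset (Fin n)) :
    Set (MvPolynomial (Var n) K) :=
  Set.range fun e : (Fin 4 ⊕ₗ σ) ↪o (σ ×ₗ Fin 3) => ((cameraMatrix A σ).submatrix e id).det

/-- The monomial ideal `M_n`, generated by the `x_i x_j`, the `x_i y_j y_k` and the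
`y_i y_j y_k y_l`, with distinct indices. -/
def monomialIdealM (K : Type*) [Field K] (n : ℕ) : Ideal (MvPolynomial (Var n) K) :=
  Ideal.span
    ({f | ∃ i j : Fin n, i ≠ j ∧ f = coord K 0 i * coord K 0 j} ∪
     {f | ∃ i j k : Fin n, [i, j, k].Nodup ∧ f = coord K 0 i * coord K 1 j * coord K 1 k} ∪
     {f | ∃ i j k l : Fin n, [i, j, k, l].Nodup ∧
        f = coord K 1 i * coord K 1 j * coord K 1 k * coord K 1 l})

end

end Multiview

/-!
Write `φ` for the ring map `x_i, y_i, z_i ↦ t_i A_i q` to a polynomial ring in `q` and `t`; the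
multiview ideal lies in its kernel. Rank the three variables of each block by a term order `m`, the
largest one having rank `0`.

*Leading terms of minors.* A maximal minor of `A_σ` that uses the row set `R_i` in the block `i` is
multilinear, and its coefficient at `∏ p_{i, s_i}` is its value at the unit vectors `p_i = e_{s_i}`.
This value is zero if some `s_i` is not in `R_i`, and otherwise it is up to sign a `4 × 4` minor of
`[A_1ᵀ ⋯ A_nᵀ]`, hence nonzero (`coeff_det_eq_zero`, `coeff_det_ne_zero`). So the leading monomial
is the product of the largest variables allowed by the `R_i`. Give a variable of rank `r` the weight
`2 - r` and a monomial the sum, over the blocks, of the largest weight of a variable that occurs.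
The row sets satisfy `∑ (|R_i| - 1) = 4`, and every monomial of weight at least `4` is divisible by
a leading monomial of a minor that again has weight at least `4`
(`exists_degree_le_of_not_isStandard`). Only the ranks depend on the term order.

*Independence of the other monomials.* The monomials of weight at most `3`, the standard ones, are
linearly independent modulo the multiview ideal (`eq_zero_of_mem_multiviewIdeal_of_isStandard`).
Passing to multihomogeneous components, take a relation among their images in `K[q]` and restrict it
to the zero set of the smallest linear form of a block. The monomials without that form survive, and
they are standard monomials of a configuration in a smaller space, so they do not occur, by
induction. The form can then be cancelled from the others, which lowers the degree. The weight bound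
guarantees that at most three forms are ever set to zero, so that by genericity the next form is not
zero on the remaining linear subspace of `K⁴` (`eq_zero_of_isStandard_of_evalAt_eq_zero`).

Division with remainder by the minors now leaves no remainder for elements of the ideal
(`exists_degree_le_of_mem`), which is the Gröbner basis property. For the lexicographic order the
variables `x_i, y_i, z_i` have the ranks `0, 1, 2`, and the monomials of weight at least `4` are
those of `M_n` (`monomial_mem_monomialIdealM`, `monomialIdealM_le`).
-/

namespace Multiview

open MvPolynomial

open scoped Matrix LinearAlgebra.Projectivization MonomialOrder

variable {K : Type*} [Field K] {n : ℕ}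

/-! ### Multidegrees -/

theorem weight_multiWeight_apply (d : Var n →₀ ℕ) (i : Fin n) :
    Finsupp.weight (multiWeight n) d i = ∑ r, d (toLex (r, i)) := by
  rw [Finsupp.weight_apply, Finsupp.sum_fintype _ _ (by simp), Finset.sum_apply,
    ← (toLex : Fin 3 × Fin n ≃ Var n).sum_comp, Fintype.sum_prod_type]
  refine Finset.sum_congr rfl fun r _ => ?_
  rw [Finset.sum_eq_single i]
  · simp [multiWeight]
  · intro j _ hj
    simp [multiWeight, Pi.single_eq_of_ne hj.symm]
  · simp

theorem prod_pow_eq_prod_pow_weight (t : Fin n → K) (d : Var n →₀ ℕ) :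
    ∏ v, t (ofLex v).2 ^ d v = ∏ i, t i ^ Finsupp.weight (multiWeight n) d i := by
  rw [← (toLex : Fin 3 × Fin n ≃ Var n).prod_comp, Fintype.prod_prod_type, Finset.prod_comm]
  refine Finset.prod_congr rfl fun i _ => ?_
  rw [weight_multiWeight_apply, ← Finset.prod_pow_eq_pow_sum]
  rfl

theorem evalAt_eq_sum (p : Fin n → Fin 3 → K) (f : MvPolynomial (Var n) K) :
    evalAt p f = ∑ d ∈ f.support, f.coeff d * ∏ v, p (ofLex v).2 (ofLex v).1 ^ d v := by
  rw [evalAt, eval_eq']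

theorem IsMultihomogeneous.evalAt_smul {u : Fin n → ℕ} {f : MvPolynomial (Var n) K}
    (hf : IsMultihomogeneous u f) (t : Fin n → K) (p : Fin n → Fin 3 → K) :
    evalAt (fun i => t i • p i) f = (∏ i, t i ^ u i) * evalAt p f := by
  rw [evalAt_eq_sum, evalAt_eq_sum, Finset.mul_sum]
  refine Finset.sum_congr rfl fun d hd => ?_
  have hw : Finsupp.weight (multiWeight n) d = u := hf (mem_support_iff.mp hd)
  simp only [Pi.smul_apply, smul_eq_mul, mul_pow, Finset.prod_mul_distrib]
  rw [prod_pow_eq_prod_pow_weight, hw]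
  ring

theorem IsMultihomogeneous.isHomogeneous {u : Fin n → ℕ} {f : MvPolynomial (Var n) K}
    (hf : IsMultihomogeneous u f) : f.IsHomogeneous (∑ i, u i) := by
  intro d hd
  rw [← hf hd, Finsupp.weight_apply, Finsupp.sum_fintype _ _ (by simp),
    ← (toLex : Fin 3 × Fin n ≃ Var n).sum_comp, Fintype.sum_prod_type, Finset.sum_comm]
  refine Finset.sum_congr rfl fun i _ => ?_
  rw [weight_multiWeight_apply]
  simp

/-- A polynomial that vanishes at all nonzero rescalings of a tuple of vectors has
multihomogeneous components that vanish at that tuple. -/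
theorem evalAt_weightedHomogeneousComponent_eq_zero [Infinite K] (p : Fin n → Fin 3 → K)
    (f : MvPolynomial (Var n) K)
    (hf : ∀ t : Fin n → K, (∀ i, t i ≠ 0) → evalAt (fun i => t i • p i) f = 0)
    (u : Fin n → ℕ) :
    evalAt p (weightedHomogeneousComponent (multiWeight n) u f) = 0 := by
  classical
  set c := fun w : Fin n → ℕ => weightedHomogeneousComponent (multiWeight n) w f
  have hfin : (Function.support c).Finite := weightedHomogeneousComponent_finsupp f
  have hsum : f = ∑ w ∈ hfin.toFinset, c w := by
    conv_lhs => rw [← sum_weightedHomogeneousComponent (multiWeight n) f]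
    exact finsum_eq_sum _ hfin
  -- the restriction of `f` to the rescalings, as a polynomial in the scaling factors
  set F : MvPolynomial (Fin n) K :=
    ∑ w ∈ hfin.toFinset, monomial (Finsupp.equivFunOnFinite.symm w) (evalAt p (c w)) with hF
  have hF0 : F = 0 := by
    refine funext_set (fun _ => {0}ᶜ) (fun _ => (Set.finite_singleton 0).infinite_compl) ?_
    intro t ht
    rw [map_zero, ← hf t fun i => ht i trivial]
    conv_rhs => rw [hsum, evalAt, map_sum]
    rw [hF, map_sum]
    refine Finset.sum_congr rfl fun w _ => ?_
    have := IsMultihomogeneous.evalAt_smul (u := w) (f := c w)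
      (weightedHomogeneousComponent_isWeightedHomogeneous w f) t p
    rw [evalAt] at this
    rw [this, eval_monomial, Finsupp.prod_fintype _ _ (by simp), mul_comm]
    rfl
  have hcoef : F.coeff (Finsupp.equivFunOnFinite.symm u) = 0 := by rw [hF0, coeff_zero]
  rw [hF, coeff_sum] at hcoef
  by_cases hu : u ∈ hfin.toFinset
  · rw [Finset.sum_eq_single u] at hcoef
    · simpa using hcoef
    · intro w _ hw
      rw [coeff_monomial, if_neg]
      exact fun h => hw (Finsupp.equivFunOnFinite.symm.injective h)
    · exact fun h => absurd hu h
  · have : c u = 0 := by simpa using hu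
    change evalAt p (c u) = 0
    rw [this, evalAt, map_zero]

/-! ### Generic configurations -/

theorem IsGenericConfiguration.eq_zero_of_mulVec_eq_zero {A : Fin n → Matrix (Fin 3) (Fin 4) K}
    (hA : IsGenericConfiguration A) {B : Finset (Fin n × Fin 3)} (hB : B.card = 4)
    {q : Fin 4 → K} (hq : ∀ b ∈ B, (A b.1 *ᵥ q) b.2 = 0) : q = 0 := by
  set e : Fin 4 ↪ Fin n × Fin 3 :=
    ((Finset.equivFinOfCardEq hB).symm.toEmbedding).trans (Function.Embedding.subtype _)
  have he : ∀ j, e j ∈ B := fun j => ((Finset.equivFinOfCardEq hB).symm j).2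
  have hdet := hA e
  rw [← Matrix.det_transpose] at hdet
  refine Matrix.eq_zero_of_mulVec_eq_zero hdet ?_
  ext j
  exact hq _ (he j)

/-- At most three rows of a generic configuration do not span another row: a common zero of the
former need not be a zero of the latter. -/
theorem IsGenericConfiguration.exists_mulVec_ne_zero {A : Fin n → Matrix (Fin 3) (Fin 4) K}
    (hn : 2 ≤ n) (hA : IsGenericConfiguration A) {B : Finset (Fin n × Fin 3)} (hB : B.card ≤ 3)
    {p : Fin n × Fin 3} (hp : p ∉ B) :
    ∃ q : Fin 4 → K, (∀ b ∈ B, (A b.1 *ᵥ q) b.2 = 0) ∧ (A p.1 *ᵥ q) p.2 ≠ 0 := by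
  classical
  obtain ⟨C, hBC, -, hC⟩ := Finset.exists_subsuperset_card_eq (n := 4)
    (Finset.subset_univ (insert p B)) ((Finset.card_insert_le _ _).trans (by omega))
    (by simp; omega)
  set e : Fin 4 ↪ Fin n × Fin 3 :=
    ((Finset.equivFinOfCardEq hC).symm.toEmbedding).trans (Function.Embedding.subtype _)
  have he : ∀ c ∈ C, ∃ j, e j = c := fun c hc =>
    ⟨Finset.equivFinOfCardEq hC ⟨c, hc⟩, by simp [e]⟩
  have hdet := hA e
  rw [← Matrix.det_transpose] at hdet
  set M := ((transposeConcat A).submatrix id e)ᵀ with hM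
  obtain ⟨j, hj⟩ := he p (hBC (Finset.mem_insert_self _ _))
  have key : ∀ i, (A (e i).1 *ᵥ (M⁻¹ *ᵥ Pi.single j 1)) (e i).2 = (Pi.single j 1 : Fin 4 → K) i := by
    intro i
    have : M *ᵥ (M⁻¹ *ᵥ Pi.single j 1) = Pi.single j (1 : K) := by
      rw [Matrix.mulVec_mulVec, Matrix.mul_nonsing_inv _ (isUnit_iff_ne_zero.mpr hdet),
        Matrix.one_mulVec]
    exact congrFun this i
  refine ⟨M⁻¹ *ᵥ Pi.single j 1, fun b hb => ?_, ?_⟩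
  · obtain ⟨i, rfl⟩ := he b (hBC (Finset.mem_insert_of_mem hb))
    rw [key, Pi.single_eq_of_ne]
    rintro rfl
    exact hp (hj ▸ hb)
  · rw [← hj, key, Pi.single_eq_same]
    exact one_ne_zero

/-- Vanishing on a linear subspace `{q | ∀ b ∈ B, (A b.1 *ᵥ q) b.2 = 0}` may be checked off a
hyperplane. -/
theorem evalAt_eq_zero_of_mul_eq_zero [Infinite K] (A : Fin n → Matrix (Fin 3) (Fin 4) K)
    (B : Finset (Fin n × Fin 3)) (p : Fin n × Fin 3) (g : MvPolynomial (Var n) K)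
    (hg : ∀ q, (∀ b ∈ B, (A b.1 *ᵥ q) b.2 = 0) →
      (A p.1 *ᵥ q) p.2 * evalAt (fun i => A i *ᵥ q) g = 0)
    {q₀ : Fin 4 → K} (hq₀ : ∀ b ∈ B, (A b.1 *ᵥ q₀) b.2 = 0) (hp : (A p.1 *ᵥ q₀) p.2 ≠ 0)
    {q : Fin 4 → K} (hq : ∀ b ∈ B, (A b.1 *ᵥ q) b.2 = 0) :
    evalAt (fun i => A i *ᵥ q) g = 0 := by
  -- restrict `g` and the linear form to the line through `q` with direction `q₀`
  set G : Polynomial K := aeval (fun v : Var n =>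
    Polynomial.C ((A (ofLex v).2 *ᵥ q) (ofLex v).1) +
      Polynomial.X * Polynomial.C ((A (ofLex v).2 *ᵥ q₀) (ofLex v).1)) g with hG
  set L : Polynomial K := Polynomial.C ((A p.1 *ᵥ q) p.2) +
    Polynomial.X * Polynomial.C ((A p.1 *ᵥ q₀) p.2) with hL
  have hGe : ∀ t : K, G.eval t = evalAt (fun i => A i *ᵥ (q + t • q₀)) g := by
    intro t
    rw [hG, ← Polynomial.coe_evalRingHom, map_aeval, evalAt, eval]
    refine eval₂Hom_congr ?_ ?_ rfl
    · ext x
      simp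
    · ext v
      simp [Matrix.mulVec_add, Matrix.mulVec_smul]
      ring
  have hLe : ∀ t : K, L.eval t = (A p.1 *ᵥ (q + t • q₀)) p.2 := by
    intro t
    simp only [hL, Matrix.mulVec_add, Matrix.mulVec_smul, Polynomial.eval_add, Polynomial.eval_mul,
      Polynomial.eval_C, Polynomial.eval_X, Pi.add_apply, Pi.smul_apply, smul_eq_mul]
  have hL0 : L ≠ 0 := by
    intro h
    apply hp
    have := congrArg (Polynomial.coeff · 1) h
    simpa [hL, Polynomial.coeff_C] using this
  have hLG : L * G = 0 := by
    refine Polynomial.funext fun t => ?_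
    rw [Polynomial.eval_mul, hLe, hGe, Polynomial.eval_zero]
    refine hg _ fun b hb => ?_
    simp [Matrix.mulVec_add, Matrix.mulVec_smul, hq b hb, hq₀ b hb]
  have h0 := hGe 0
  rw [(mul_eq_zero.mp hLG).resolve_left hL0] at h0
  simpa using h0.symm

/-! ### Standard monomials and their linear independence -/

/-- The variables of the `i`-th block are ranked by `ρ i`, the rank `0` being the largest one.
With the caps `k`, a monomial `d` is standard if it only involves variables of rank at most `k i`
in the block `i`, and if the ranks in the block `i` that occur in `d` have lower bounds
`l i ≤ k i` with `∑ i, (2 - l i) ≤ 3`. For `k = 2` and `ρ = 1` these are the monomials outside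
`monomialIdealM`; smaller caps describe the monomials that survive on a linear subspace of `K⁴`. -/
def IsStandard (ρ : Fin n → Equiv.Perm (Fin 3)) (k : Fin n → ℕ) (d : Var n →₀ ℕ) : Prop :=
  ∃ l : Fin n → ℕ, (∀ i, l i ≤ k i) ∧
    (∀ r i, d (toLex (r, i)) ≠ 0 → l i ≤ (ρ i r : ℕ) ∧ (ρ i r : ℕ) ≤ k i) ∧
    ∑ i, (2 - l i) ≤ 3

theorem IsStandard.mono {ρ : Fin n → Equiv.Perm (Fin 3)} {k : Fin n → ℕ} {d e : Var n →₀ ℕ}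
    (hd : IsStandard ρ k d) (h : e ≤ d) : IsStandard ρ k e := by
  obtain ⟨l, h1, h2, h3⟩ := hd
  refine ⟨l, h1, fun r i hr => h2 r i fun h0 => hr ?_, h3⟩
  have := h (toLex (r, i))
  omega

theorem card_rank_gt (ρ : Fin n → Equiv.Perm (Fin 3)) {k : Fin n → ℕ} (hk : ∀ i, k i ≤ 2) :
    (Finset.univ.filter fun b : Fin n × Fin 3 => k b.1 < (ρ b.1 b.2 : ℕ)).card =
      ∑ i, (2 - k i) := by
  rw [Finset.card_filter, Fintype.sum_prod_type]
  refine Finset.sum_congr rfl fun i _ => ?_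
  refine (Equiv.sum_comp (ρ i) fun r : Fin 3 => if k i < (r : ℕ) then 1 else 0).trans ?_
  have := hk i
  generalize k i = m at *
  interval_cases m <;> rfl

/-- A multihomogeneous combination of standard monomials that vanishes at all `(A_i q)_i`, with
`q` in the linear subspace where the forms of rank `> k i` vanish, is zero. Restriction to the zero
set of the smallest form still present in some block isolates the monomials without the
corresponding variable `v`; these vanish by induction on the caps. The others have the factor `v`,
which can be cancelled, and induction on the degree applies. -/
theorem eq_zero_of_isStandard_of_evalAt_eq_zero [Infinite K] (hn : 2 ≤ n)
    {A : Fin n → Matrix (Fin 3) (Fin 4) K} (hA : IsGenericConfiguration A)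
    (ρ : Fin n → Equiv.Perm (Fin 3)) (u k : Fin n → ℕ) (f : MvPolynomial (Var n) K)
    (hk : ∀ i, k i ≤ 2) (hu : IsMultihomogeneous u f) (hf : ∀ d ∈ f.support, IsStandard ρ k d)
    (hv : ∀ q, (∀ i r, k i < (ρ i r : ℕ) → (A i *ᵥ q) r = 0) →
      evalAt (fun i => A i *ᵥ q) f = 0) : f = 0 := by
  classical
  induction hN : ∑ i, u i + ∑ i, k i using Nat.strong_induction_on generalizing u k f with
  | _ N ih =>
  subst hN
  by_contra hf0
  obtain ⟨d₀, hd₀⟩ := Finset.nonempty_iff_ne_empty.mpr (mt support_eq_empty.mp hf0)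
  by_cases hu0 : u = 0
  · -- a polynomial of multidegree zero is constant
    have hd : ∀ d ∈ f.support, d = 0 := by
      intro d hd
      ext v
      have h := congrFun (hu (mem_support_iff.mp hd)) (ofLex v).2
      rw [weight_multiWeight_apply, hu0] at h
      exact (Finset.sum_eq_zero_iff.mp h) (ofLex v).1 (Finset.mem_univ _)
    have h0 := hv 0 fun i r _ => by simp
    rw [evalAt_eq_sum, Finset.sum_eq_single d₀] at h0
    · rw [hd d₀ hd₀] at h0 hd₀
      exact (mem_support_iff.mp hd₀) (by simpa using h0)
    · intro d h1 h2
      exact absurd ((hd d h1).trans (hd d₀ hd₀).symm) h2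
    · exact fun h => absurd hd₀ h
  obtain ⟨i, hi⟩ := Function.ne_iff.mp hu0
  rw [Pi.zero_apply] at hi
  have hki := hk i
  obtain ⟨r, hr⟩ : ∃ r, (ρ i r : ℕ) = k i := ⟨(ρ i).symm ⟨k i, by omega⟩, by simp⟩
  set v : Var n := toLex (r, i) with hv_def
  set f₀ := f.modMonomial (Finsupp.single v 1) with hf₀
  set g := f.divMonomial (Finsupp.single v 1) with hg
  have hfg : X v * g + f₀ = f := divMonomial_add_modMonomial_single f v
  have hsupp₀ : ∀ d, f₀.coeff d ≠ 0 → f.coeff d ≠ 0 ∧ d v = 0 := by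
    intro d hd
    by_cases h : Finsupp.single v 1 ≤ d
    · exact absurd (coeff_modMonomial_of_le f h) hd
    · rw [hf₀, coeff_modMonomial_of_not_le f h] at hd
      refine ⟨hd, ?_⟩
      rw [Finsupp.single_le_iff] at h
      omega
  have heval : ∀ q, evalAt (fun i => A i *ᵥ q) f =
      (A i *ᵥ q) r * evalAt (fun i => A i *ᵥ q) g + evalAt (fun i => A i *ᵥ q) f₀ := by
    intro q
    rw [← hfg, evalAt, map_add, map_mul, eval_X]
    rfl
  -- in the monomials without `v`, the ranks occurring in the block `i` are smaller than `k i`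
  have hlow : ∀ d, f₀.coeff d ≠ 0 → ∃ s, d (toLex (s, i)) ≠ 0 ∧ (ρ i s : ℕ) < k i ∧
      ∀ s, d (toLex (s, i)) ≠ 0 → (ρ i s : ℕ) < k i := by
    intro d hd
    obtain ⟨h1, h2⟩ := hsupp₀ d hd
    have h3 := congrFun (hu h1) i
    rw [weight_multiWeight_apply] at h3
    obtain ⟨s, -, hs⟩ := Finset.exists_ne_zero_of_sum_ne_zero (h3.trans_ne hi)
    obtain ⟨l, -, hl, -⟩ := hf d (mem_support_iff.mpr h1)
    have hlt : ∀ s, d (toLex (s, i)) ≠ 0 → (ρ i s : ℕ) < k i := by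
      intro s hs
      refine lt_of_le_of_ne (hl s i hs).2 fun h => hs ?_
      have : s = r := (ρ i).injective (Fin.ext (h.trans hr.symm))
      rw [this]
      exact h2
    exact ⟨s, hs, hlt s hs, hlt⟩
  have hf₀0 : f₀ = 0 := by
    by_contra hne
    obtain ⟨d₁, hd₁⟩ := Finset.nonempty_iff_ne_empty.mpr (mt support_eq_empty.mp hne)
    obtain ⟨s, hs, hsk, -⟩ := hlow d₁ (mem_support_iff.mp hd₁)
    have hk1 : ∀ j, Function.update k i (k i - 1) j ≤ k j := by
      intro j
      rcases eq_or_ne j i with rfl | hj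
      · simp
      · simp [hj]
    have hlt : ∑ j, Function.update k i (k i - 1) j < ∑ j, k j := by
      refine Finset.sum_lt_sum (fun j _ => hk1 j) ⟨i, Finset.mem_univ _, ?_⟩
      simp
      omega
    refine hne (ih _ (by omega) u (Function.update k i (k i - 1)) f₀
      (fun j => (hk1 j).trans (hk j)) (fun d hd => hu (hsupp₀ d hd).1) ?_ ?_ rfl)
    · intro d hd
      rw [mem_support_iff] at hd
      obtain ⟨s, hs, hsk, hall⟩ := hlow d hd
      obtain ⟨l, hl1, hl2, hl3⟩ := hf d (mem_support_iff.mpr (hsupp₀ d hd).1)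
      refine ⟨l, fun j => ?_, fun s j hsj => ⟨(hl2 s j hsj).1, ?_⟩, hl3⟩
      · rcases eq_or_ne j i with rfl | hj
        · have := (hl2 s j hs).1
          simp
          omega
        · simpa [hj] using hl1 j
      · rcases eq_or_ne j i with rfl | hj
        · have := hall s hsj
          simp
          omega
        · simpa [hj] using (hl2 s j hsj).2
    · intro q hq
      have h1 := hv q fun j s hjs => hq j s ((hk1 j).trans_lt hjs)
      rw [heval, hq i r (by simp; omega), zero_mul, zero_add] at h1
      exact h1
  set B := Finset.univ.filter fun b : Fin n × Fin 3 => k b.1 < (ρ b.1 b.2 : ℕ) with hB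
  have hmemB : ∀ q, (∀ b ∈ B, (A b.1 *ᵥ q) b.2 = 0) ↔
      ∀ i r, k i < (ρ i r : ℕ) → (A i *ᵥ q) r = 0 := by
    intro q
    simp [hB]
  have hBcard : B.card ≤ 3 := by
    obtain ⟨l, hl1, -, hl3⟩ := hf d₀ hd₀
    rw [hB, card_rank_gt ρ hk]
    exact (Finset.sum_le_sum fun j _ => Nat.sub_le_sub_left (hl1 j) 2).trans hl3
  obtain ⟨q₀, hq₀, hq₀'⟩ := hA.exists_mulVec_ne_zero hn hBcard (p := (i, r)) (by simp [hB, hr])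
  have hlt : ∑ j, Function.update u i (u i - 1) j < ∑ j, u j := by
    refine Finset.sum_lt_sum (fun j _ => ?_) ⟨i, Finset.mem_univ _, ?_⟩
    · rcases eq_or_ne j i with rfl | hj
      · simp
      · simp [hj]
    · simp
      omega
  have hg0 : g = 0 := by
    refine ih _ (by omega) (Function.update u i (u i - 1)) k g hk ?_ ?_ ?_ rfl
    · intro d hd
      rw [hg, coeff_divMonomial] at hd
      have h := hu hd
      ext j
      have hj' := congrFun h j
      rw [map_add, Pi.add_apply, Finsupp.weight_apply, Finsupp.sum_single_index (by simp)] at hj'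
      rcases eq_or_ne j i with rfl | hj
      · simp [multiWeight, hv_def] at hj' ⊢
        omega
      · simpa [multiWeight, hv_def, hj] using hj'
    · intro d hd
      rw [mem_support_iff, hg, coeff_divMonomial] at hd
      exact (hf _ (mem_support_iff.mpr hd)).mono le_add_self
    · intro q hq
      refine evalAt_eq_zero_of_mul_eq_zero A B (i, r) g ?_ hq₀ hq₀' ((hmemB q).mpr hq)
      intro q' hq'
      have := hv q' ((hmemB q').mp hq')
      rwa [heval, hf₀0, evalAt, evalAt, map_zero, add_zero] at this
  exact hf0 (by rw [← hfg, hg0, hf₀0, mul_zero, add_zero])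

/-- A polynomial in the multiview ideal vanishes at all tuples `(t_i A_i q)_i` that represent points
of `(ℙ²)ⁿ`. -/
theorem evalAt_eq_zero_of_mem_multiviewIdeal {A : Fin n → Matrix (Fin 3) (Fin 4) K}
    {f : MvPolynomial (Var n) K} (hf : f ∈ multiviewIdeal A) {q : Fin 4 → K}
    (hq : ∀ i, A i *ᵥ q ≠ 0) (hq0 : q ≠ 0) {t : Fin n → K} (ht : ∀ i, t i ≠ 0) :
    evalAt (fun i => t i • A i *ᵥ q) f = 0 := by
  obtain ⟨c, hc⟩ := Projectivization.exists_smul_eq_mk_rep K q hq0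
  have hrep : ∀ i, A i *ᵥ (Projectivization.mk K q hq0).rep = c • A i *ᵥ q := by
    intro i
    rw [← hc, Matrix.mulVec_smul]
  have hdom : ∀ i, A i *ᵥ (Projectivization.mk K q hq0).rep ≠ 0 := by
    intro i
    rw [hrep]
    exact (smul_ne_zero_iff_ne c).mpr (hq i)
  refine hf (multiviewMap A ⟨Projectivization.mk K q hq0, hdom⟩)
    (fun u g _ hg => hg _ (Set.mem_range_self _)) _ (fun i => smul_ne_zero (ht i) (hq i)) ?_
  intro i
  rw [multiviewMap, Projectivization.mk_eq_mk_iff']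
  refine ⟨t i * (c⁻¹ : Kˣ), ?_⟩
  dsimp only
  rw [hrep, Units.smul_def, smul_smul, mul_assoc, Units.inv_mul, mul_one]

/-- The standard monomials are linearly independent modulo the multiview ideal. -/
theorem eq_zero_of_mem_multiviewIdeal_of_isStandard [Infinite K] (hn : 2 ≤ n)
    {A : Fin n → Matrix (Fin 3) (Fin 4) K} (hA : IsGenericConfiguration A)
    (ρ : Fin n → Equiv.Perm (Fin 3)) {f : MvPolynomial (Var n) K} (hf : f ∈ multiviewIdeal A)
    (hstd : ∀ d ∈ f.support, IsStandard ρ (fun _ => 2) d) : f = 0 := by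
  classical
  suffices h : ∀ u, weightedHomogeneousComponent (multiWeight n) u f = 0 by
    rw [← sum_weightedHomogeneousComponent (multiWeight n) f]
    simp [h]
  intro u
  set g := weightedHomogeneousComponent (multiWeight n) u f with hg
  refine eq_zero_of_isStandard_of_evalAt_eq_zero hn hA ρ u (fun _ => 2) g (fun _ => le_rfl)
    (weightedHomogeneousComponent_isWeightedHomogeneous u f) ?_ fun q _ => ?_
  · intro d hd
    rw [mem_support_iff, hg, coeff_weightedHomogeneousComponent] at hd
    exact hstd d (mem_support_iff.mpr fun h => hd (by simp [h]))
  -- `g` vanishes wherever the first coordinates of all `A_i q` are nonzero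
  set ℓ : Fin n → Fin 3 → MvPolynomial (Fin 4) K := fun i r => ∑ c, C (A i r c) * X c with hℓ
  have hℓe : ∀ i r q, eval q (ℓ i r) = (A i *ᵥ q) r := by
    intro i r q
    simp [hℓ, Matrix.mulVec, dotProduct]
  set F : MvPolynomial (Fin 4) K := aeval (fun v : Var n => ℓ (ofLex v).2 (ofLex v).1) g with hF
  have hFe : ∀ q, eval q F = evalAt (fun i => A i *ᵥ q) g := by
    intro q
    rw [hF, map_aeval, evalAt]
    refine eval₂Hom_congr ?_ ?_ rfl
    · ext x
      simp
    · ext v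
      exact hℓe _ _ _
  have hprod : ∏ i, ℓ i 0 ≠ 0 := by
    refine Finset.prod_ne_zero_iff.mpr fun i _ h => ?_
    obtain ⟨q, -, hq⟩ := hA.exists_mulVec_ne_zero hn (B := ∅) (by simp) (p := (i, 0)) (by simp)
    exact hq (by rw [← hℓe, h, map_zero])
  have hmul : (∏ i, ℓ i 0) * F = 0 := by
    refine MvPolynomial.funext fun q => ?_
    rw [map_mul, map_zero, map_prod, mul_eq_zero, or_iff_not_imp_left, ← Ne,
      Finset.prod_ne_zero_iff]
    intro hne
    have hne' : ∀ i, A i *ᵥ q ≠ 0 := by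
      intro i h
      refine hne i (Finset.mem_univ _) ?_
      rw [hℓe, h, Pi.zero_apply]
    have hq0 : q ≠ 0 := by
      rintro rfl
      exact hne' ⟨0, by omega⟩ (Matrix.mulVec_zero _)
    rw [hFe]
    exact evalAt_weightedHomogeneousComponent_eq_zero _ f
      (fun t ht => evalAt_eq_zero_of_mem_multiviewIdeal hf hne' hq0 ht) u
  rw [← hFe, (mul_eq_zero.mp hmul).resolve_left hprod, map_zero]

/-! ### The maximal minors -/

theorem isMultihomogeneous_of_mem_maximalMinors {A : Fin n → Matrix (Fin 3) (Fin 4) K}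
    {σ : Finset (Fin n)} {f : MvPolynomial (Var n) K} (hf : f ∈ maximalMinors A σ) :
    IsMultihomogeneous (fun i => if i ∈ σ then 1 else 0) f := by
  classical
  obtain ⟨e, rfl⟩ := hf
  -- the entries of a column of `A_σ` are homogeneous of the same multidegree
  set w : Fin 4 ⊕ₗ σ → Fin n → ℕ := fun c =>
    Sum.elim (fun _ => 0) (fun j : σ => Pi.single (j : Fin n) 1) (ofLex c) with hw
  have hsum : ∑ c, w c = fun i => if i ∈ σ then 1 else 0 := by
    rw [← (toLex : Fin 4 ⊕ σ ≃ _).sum_comp, Fintype.sum_sum_type]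
    ext i
    simp only [hw, ofLex_toLex, Sum.elim_inl, Sum.elim_inr, Finset.sum_const_zero, zero_add,
      Finset.sum_apply]
    rw [Finset.sum_coe_sort σ fun j => (Pi.single j 1 : Fin n → ℕ) i]
    simp [Pi.single_apply]
  dsimp only
  rw [Matrix.det_apply, ← hsum]
  refine IsWeightedHomogeneous.sum _ _ _ fun π _ => ?_
  have hprod : IsWeightedHomogeneous (multiWeight n)
      (∏ c, (cameraMatrix A σ).submatrix e id (π c) c) (∑ c, w c) := by
    refine IsWeightedHomogeneous.prod _ _ _ fun c _ => ?_
    rcases c with c | j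
    · exact isWeightedHomogeneous_C _ _
    · change IsWeightedHomogeneous _ (if _ then _ else _) _
      split_ifs
      · exact isWeightedHomogeneous_X _ _ _
      · exact isWeightedHomogeneous_zero _ _ _
  rcases Int.units_eq_one_or (Equiv.Perm.sign π) with h | h
  · rw [h, one_smul]
    exact hprod
  · rw [h, Units.neg_smul, one_smul]
    exact hprod.neg

theorem evalAt_det (A : Fin n → Matrix (Fin 3) (Fin 4) K) {σ : Finset (Fin n)}
    (e : (Fin 4 ⊕ₗ σ) ↪o (σ ×ₗ Fin 3)) (p : Fin n → Fin 3 → K) :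
    evalAt p ((cameraMatrix A σ).submatrix e id).det =
      (((cameraMatrix A σ).map (evalAt p)).submatrix e id).det :=
  RingHom.map_det (eval fun v : Var n => p (ofLex v).2 (ofLex v).1) _

/-- The specialization of `A_σ` at `p` maps `(q, t)` to `(A_i q + t_i p_i)_i`. -/
theorem cameraMatrix_map_mulVec (A : Fin n → Matrix (Fin 3) (Fin 4) K) {σ : Finset (Fin n)}
    (p : Fin n → Fin 3 → K) (x : Fin 4 ⊕ₗ σ → K) (i : σ) (r : Fin 3) :
    ((cameraMatrix A σ).map (evalAt p) *ᵥ x) (toLex (i, r)) =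
      (A i *ᵥ fun c => x (toLex (Sum.inl c))) r + x (toLex (Sum.inr i)) * p i r := by
  rw [Matrix.mulVec, dotProduct, ← (toLex : Fin 4 ⊕ σ ≃ _).sum_comp, Fintype.sum_sum_type]
  congr 1
  · change _ = ∑ c, A i r c * x (toLex (Sum.inl c))
    refine Finset.sum_congr rfl fun c _ => ?_
    simp [cameraMatrix, evalAt]
  · rw [Finset.sum_eq_single i]
    · simp [cameraMatrix, evalAt, coord, mul_comm]
    · intro j _ hj
      simp [cameraMatrix, evalAt, hj.symm]
    · simp

theorem mem_multiviewIdeal_of_mem_maximalMinors {A : Fin n → Matrix (Fin 3) (Fin 4) K}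
    {σ : Finset (Fin n)} {f : MvPolynomial (Var n) K} (hf : f ∈ maximalMinors A σ) :
    f ∈ multiviewIdeal A := by
  classical
  intro P hP
  refine hP _ f (isMultihomogeneous_of_mem_maximalMinors hf) ?_
  rintro _ ⟨⟨q, hq⟩, rfl⟩ p hp hpq
  obtain ⟨e, rfl⟩ := hf
  have h : ∀ i, ∃ t : K, t • A i *ᵥ q.rep = p i := by
    intro i
    exact (Projectivization.mk_eq_mk_iff' K _ _ _ _).mp (hpq i)
  choose t ht using h
  have ht0 : ∀ i, t i ≠ 0 := by
    intro i h0
    refine hp i ?_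
    rw [← ht, h0, zero_smul]
  rw [evalAt_det]
  -- the nonzero vector `(q, -t⁻¹)` is in the kernel
  refine Matrix.exists_mulVec_eq_zero_iff.mp ⟨fun c =>
    Sum.elim q.rep (fun j : σ => -(t j)⁻¹) (ofLex c), fun h0 => q.rep_nonzero ?_, ?_⟩
  · ext c
    exact congrFun h0 (toLex (Sum.inl c))
  · ext c
    have := cameraMatrix_map_mulVec A p (fun c : Fin 4 ⊕ₗ σ =>
      Sum.elim q.rep (fun j : σ => -(t j)⁻¹) (ofLex c)) (ofLex (e c)).1 (ofLex (e c)).2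
    refine Eq.trans this ?_
    have hi := ht0 (ofLex (e c)).1
    simp only [ofLex_toLex, Sum.elim_inl, Sum.elim_inr, ← ht, Pi.smul_apply, smul_eq_mul]
    rw [neg_mul, inv_mul_cancel_left₀ hi]
    exact add_neg_cancel _

/-- The exponent of the monomial that is the product, over `i ∈ σ`, of the coordinates `s i` of the
vectors `p_i`. -/
noncomputable def transversalExponent (σ : Finset (Fin n)) (s : Fin n → Fin 3) : Var n →₀ ℕ :=
  ∑ i ∈ σ, Finsupp.single (toLex (s i, i)) 1

theorem transversalExponent_apply (σ : Finset (Fin n)) (s : Fin n → Fin 3) (r : Fin 3)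
    (i : Fin n) : transversalExponent σ s (toLex (r, i)) = if i ∈ σ ∧ r = s i then 1 else 0 := by
  classical
  have h : ∀ j, (Finsupp.single (toLex (s j, j)) 1 : Var n →₀ ℕ) (toLex (r, i)) =
      if i = j then (if r = s i then 1 else 0) else 0 := by
    intro j
    rw [Finsupp.single_apply, ← ite_and]
    refine if_congr ?_ rfl rfl
    rw [toLex.injective.eq_iff, Prod.mk.injEq]
    constructor
    · rintro ⟨rfl, rfl⟩
      exact ⟨rfl, rfl⟩
    · rintro ⟨rfl, rfl⟩
      exact ⟨rfl, rfl⟩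
  rw [transversalExponent, Finsupp.finsetSum_apply]
  rw [Finset.sum_congr rfl fun j _ => h j, Finset.sum_ite_eq, ← ite_and]

/-- A monomial of multidegree `(1)_{i ∈ σ}` is a product of one coordinate for each `i ∈ σ`. -/
theorem exists_eq_transversalExponent {σ : Finset (Fin n)} {d : Var n →₀ ℕ}
    (hd : Finsupp.weight (multiWeight n) d = fun i => if i ∈ σ then 1 else 0) :
    ∃ s, d = transversalExponent σ s := by
  have h : ∀ i, ∃ s, ∀ r, d (toLex (r, i)) = if i ∈ σ ∧ r = s then 1 else 0 := by
    intro i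
    have hi := congrFun hd i
    rw [weight_multiWeight_apply] at hi
    by_cases hσ : i ∈ σ
    · obtain ⟨s, -, hs⟩ := Finset.exists_ne_zero_of_sum_ne_zero
        (hi.trans_ne (by simp [hσ]))
      refine ⟨s, fun r => ?_⟩
      rw [← Finset.add_sum_erase _ _ (Finset.mem_univ s)] at hi
      simp only [hσ, if_true, true_and] at hi ⊢
      split_ifs with hr
      · subst hr
        omega
      · have : ∑ x ∈ Finset.univ.erase s, d (toLex (x, i)) = 0 := by omega
        exact Finset.sum_eq_zero_iff.mp this r (by simp [hr])
    · refine ⟨0, fun r => ?_⟩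
      simp only [hσ, if_false, false_and] at hi ⊢
      exact Finset.sum_eq_zero_iff.mp hi r (Finset.mem_univ _)
  choose s hs using h
  refine ⟨s, ?_⟩
  ext v
  exact (hs _ _).trans (transversalExponent_apply σ s _ _).symm

/-- The coefficients of a multilinear polynomial are its values at tuples of unit vectors. -/
theorem IsMultihomogeneous.evalAt_unit {σ : Finset (Fin n)} {f : MvPolynomial (Var n) K}
    (hf : IsMultihomogeneous (fun i => if i ∈ σ then 1 else 0) f) (s : Fin n → Fin 3) :
    evalAt (fun i => Pi.single (s i) 1) f = f.coeff (transversalExponent σ s) := by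
  classical
  rw [evalAt_eq_sum, Finset.sum_eq_single (transversalExponent σ s)]
  · rw [Finset.prod_eq_one, mul_one]
    intro v _
    have := transversalExponent_apply σ s (ofLex v).1 (ofLex v).2
    change transversalExponent σ s v = _ at this
    rw [this]
    split_ifs with h
    · simp [h.2]
    · simp
  · intro d hd hne
    obtain ⟨s', rfl⟩ := exists_eq_transversalExponent (hf (mem_support_iff.mp hd))
    obtain ⟨i, hi, hsi⟩ : ∃ i ∈ σ, s' i ≠ s i := by
      by_contra! h
      refine hne (Finset.sum_congr rfl fun i hi => ?_)
      rw [h i hi]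
    rw [Finset.prod_eq_zero (Finset.mem_univ (toLex (s' i, i))), mul_zero]
    rw [transversalExponent_apply]
    simp [hi, hsi]
  · intro h
    rw [notMem_support_iff.mp h, zero_mul]

/-- If the row `(i, s i)` is left out for some `i ∈ σ`, then the specialization at the unit vectors
`e_{s i}` has a zero column. -/
theorem coeff_det_eq_zero (A : Fin n → Matrix (Fin 3) (Fin 4) K) {σ : Finset (Fin n)}
    (e : (Fin 4 ⊕ₗ σ) ↪o (σ ×ₗ Fin 3)) (s : Fin n → Fin 3) (i : σ)
    (hi : toLex (i, s i) ∉ Set.range e) :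
    (((cameraMatrix A σ).submatrix e id).det).coeff (transversalExponent σ s) = 0 := by
  classical
  rw [← (isMultihomogeneous_of_mem_maximalMinors
    (A := A) (Set.mem_range_self e)).evalAt_unit s, evalAt_det]
  refine Matrix.det_eq_zero_of_column_eq_zero (toLex (Sum.inr i)) fun c => ?_
  rw [Matrix.submatrix_apply, id_eq, Matrix.map_apply]
  simp only [cameraMatrix, Matrix.of_apply, ofLex_toLex, Sum.elim_inr]
  split_ifs with h
  · have : (ofLex (e c)).2 ≠ s i := by
      intro h2
      refine hi ⟨c, ?_⟩
      rw [← h2, ← h]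
      rfl
    simp [evalAt, coord, this]
  · simp [evalAt]

/-- If all rows `(i, s i)`, `i ∈ σ`, occur, then the coefficient of the corresponding monomial is,
up to sign, the minor of `[A_1ᵀ ⋯ A_nᵀ]` given by the four other rows. -/
theorem coeff_det_ne_zero {A : Fin n → Matrix (Fin 3) (Fin 4) K}
    (hA : IsGenericConfiguration A) {σ : Finset (Fin n)}
    (e : (Fin 4 ⊕ₗ σ) ↪o (σ ×ₗ Fin 3)) (s : Fin n → Fin 3)
    (hs : ∀ i : σ, toLex (i, s i) ∈ Set.range e) :
    (((cameraMatrix A σ).submatrix e id).det).coeff (transversalExponent σ s) ≠ 0 := by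
  classical
  rw [← (isMultihomogeneous_of_mem_maximalMinors
    (A := A) (Set.mem_range_self e)).evalAt_unit s, evalAt_det]
  intro h0
  obtain ⟨x, hx, hx0⟩ := Matrix.exists_mulVec_eq_zero_iff.mpr h0
  have hrow : ∀ (i : σ) (r : Fin 3), toLex (i, r) ∈ Set.range e →
      (A i *ᵥ fun c => x (toLex (Sum.inl c))) r +
        x (toLex (Sum.inr i)) * (Pi.single (s i) 1 : Fin 3 → K) r = 0 := by
    rintro i r ⟨c, hc⟩
    rw [← cameraMatrix_map_mulVec A (fun i => Pi.single (s i) 1), ← hc]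
    exact congrFun hx0 c
  choose c hc using hs
  have hcinj : Function.Injective c := by
    intro i j hij
    have := congrArg e hij
    rw [hc, hc] at this
    exact congrArg (fun y => (ofLex y).1) this
  -- the four rows other than the `(i, s i)`
  set R : Finset (Fin 4 ⊕ₗ σ) := (Finset.univ.image c)ᶜ with hR
  have hRcard : R.card = 4 := by
    rw [hR, Finset.card_compl, Finset.card_image_of_injective _ hcinj]
    have : Fintype.card (Fin 4 ⊕ₗ σ) = 4 + σ.card := by
      rw [Fintype.card_lex, Fintype.card_sum, Fintype.card_fin, Fintype.card_coe]
    rw [this]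
    simp
  have hmapinj : Function.Injective
      (fun b : Fin 4 ⊕ₗ σ => (((ofLex (e b)).1 : Fin n), (ofLex (e b)).2)) := by
    intro a b hab
    simp only [Prod.mk.injEq] at hab
    refine e.injective (ofLex.injective (Prod.ext (Subtype.ext hab.1) hab.2))
  have hq : (fun c => x (toLex (Sum.inl c))) = 0 := by
    refine hA.eq_zero_of_mulVec_eq_zero
      (B := R.image fun b => (((ofLex (e b)).1 : Fin n), (ofLex (e b)).2))
      (by rw [Finset.card_image_of_injective _ hmapinj, hRcard]) ?_
    intro b hb
    obtain ⟨a, ha, rfl⟩ := Finset.mem_image.mp hb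
    have h := hrow (ofLex (e a)).1 (ofLex (e a)).2 ⟨a, rfl⟩
    rw [Pi.single_eq_of_ne, mul_zero, add_zero] at h
    · exact h
    · intro h2
      rw [hR, Finset.mem_compl] at ha
      refine ha (Finset.mem_image.mpr ⟨(ofLex (e a)).1, Finset.mem_univ _, ?_⟩)
      apply e.injective
      rw [hc, ← h2]
      rfl
  refine hx ?_
  ext a
  rcases a with a | i
  · exact congrFun hq a
  · have h := hrow i (s i) ⟨c i, hc i⟩
    rw [hq, Matrix.mulVec_zero, Pi.single_eq_same, mul_one, Pi.zero_apply, zero_add] at h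
    exact h

/-! ### Leading monomials of the minors -/

/-- The variables of every block are sorted by their ranks, in decreasing order. -/
def SortsBlocks (m : MonomialOrder (Var n)) (ρ : Fin n → Equiv.Perm (Fin 3)) : Prop :=
  ∀ i r s, ρ i r ≤ ρ i s →
    Finsupp.single (toLex (s, i)) 1 ≼[m] Finsupp.single (toLex (r, i)) 1

theorem exists_sortsBlocks (m : MonomialOrder (Var n)) : ∃ ρ, SortsBlocks m ρ := by
  refine ⟨fun i => (Tuple.sort fun r : Fin 3 =>
    OrderDual.toDual (m.toSyn (Finsupp.single (toLex (r, i)) 1))).symm, fun i r s h => ?_⟩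
  have := Tuple.monotone_sort (fun r : Fin 3 =>
    OrderDual.toDual (m.toSyn (Finsupp.single (toLex (r, i)) 1))) h
  simpa using this

theorem sortsBlocks_lex :
    SortsBlocks (MonomialOrder.lex : MonomialOrder (Var n)) fun _ => Equiv.refl _ := by
  intro i r s h
  rw [MonomialOrder.lex_le_iff]
  rcases h.eq_or_lt with h | h
  · rw [show r = s from h]
  · refine le_of_lt (Finsupp.Lex.single_lt_iff.mpr ?_)
    exact Prod.Lex.toLex_lt_toLex.mpr (Or.inl h)

theorem exists_le_sum_eq {ι : Type*} [Fintype ι] (w : ι → ℕ) {t : ℕ} (ht : t ≤ ∑ i, w i) :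
    ∃ w' : ι → ℕ, (∀ i, w' i ≤ w i) ∧ ∑ i, w' i = t := by
  classical
  induction t with
  | zero => exact ⟨0, fun _ => Nat.zero_le _, by simp⟩
  | succ t ih =>
    obtain ⟨w', h1, h2⟩ := ih (by omega)
    obtain ⟨i, -, hi⟩ := Finset.exists_lt_of_sum_lt (h2.trans_lt ht)
    refine ⟨w' + Pi.single i 1, fun j => ?_, ?_⟩
    · rcases eq_or_ne j i with rfl | hj
      · simpa using hi
      · simpa [hj] using h1 j
    · simp [Finset.sum_add_distrib, h2]

/-- A monomial that is not standard is divisible by the leading monomial of a maximal minor, which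
is itself not standard. -/
theorem exists_degree_le_of_not_isStandard {A : Fin n → Matrix (Fin 3) (Fin 4) K}
    (hA : IsGenericConfiguration A) {m : MonomialOrder (Var n)} {ρ : Fin n → Equiv.Perm (Fin 3)}
    (hρ : SortsBlocks m ρ) {d : Var n →₀ ℕ} (hd : ¬ IsStandard ρ (fun _ => 2) d) :
    ∃ f : MvPolynomial (Var n) K,
      (∃ σ : Finset (Fin n), 2 ≤ σ.card ∧ σ.card ≤ 4 ∧ f ∈ maximalMinors A σ) ∧ f ≠ 0 ∧
        m.degree f ≤ d ∧ ¬ IsStandard ρ (fun _ => 2) (m.degree f) := by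
  classical
  -- the least rank of a variable that occurs in `d`, for every block
  have hmin : ∀ i, ∃ l : ℕ, l ≤ 2 ∧ (∀ r, d (toLex (r, i)) ≠ 0 → l ≤ (ρ i r : ℕ)) ∧
      (l < 2 → ∃ r, d (toLex (r, i)) ≠ 0 ∧ (ρ i r : ℕ) = l) := by
    intro i
    have hex : ∃ l : ℕ, l = 2 ∨ ∃ r, d (toLex (r, i)) ≠ 0 ∧ (ρ i r : ℕ) = l := ⟨2, Or.inl rfl⟩
    refine ⟨Nat.find hex, Nat.find_min' hex (Or.inl rfl), fun r hr =>
      Nat.find_min' hex (Or.inr ⟨r, hr, rfl⟩), fun h => ?_⟩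
    exact (Nat.find_spec hex).resolve_left h.ne
  choose l hl2 hl hl' using hmin
  have hsum : 4 ≤ ∑ i, (2 - l i) := by
    by_contra! h
    exact hd ⟨l, hl2, fun r i hr => ⟨hl i r hr, Nat.le_of_lt_succ (ρ i r).2⟩, by omega⟩
  obtain ⟨w, hw, hw4⟩ := exists_le_sum_eq _ hsum
  set σ : Finset (Fin n) := Finset.univ.filter fun i => w i ≠ 0 with hσ
  have hσw : ∑ i ∈ σ, w i = 4 := by
    rw [hσ, Finset.sum_filter_ne_zero, hw4]
  have hσ1 : ∀ i ∈ σ, 1 ≤ w i := by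
    intro i hi
    have : w i ≠ 0 := by simpa [hσ] using hi
    omega
  have hσ4 : σ.card ≤ 4 := by
    have := Finset.card_nsmul_le_sum σ w 1 hσ1
    simpa [hσw] using this
  have hσ2 : 2 ≤ σ.card := by
    have := Finset.sum_le_card_nsmul σ w 2 fun i _ => (hw i).trans (Nat.sub_le _ _)
    rw [hσw, smul_eq_mul] at this
    omega
  -- the rows of the minor: in the block `i`, the row of the least rank in `d` and `w i` rows of
  -- larger rank
  have hrows : ∀ i, ∃ (a : Fin 3) (R : Finset (Fin 3)), i ∈ σ →
      d (toLex (a, i)) ≠ 0 ∧ (ρ i a : ℕ) = l i ∧ a ∈ R ∧ (∀ r ∈ R, ρ i a ≤ ρ i r) ∧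
        R.card = w i + 1 := by
    intro i
    by_cases hi : i ∈ σ
    · have h1 := hσ1 i hi
      have h2 := hw i
      obtain ⟨a, ha, hal⟩ := hl' i (by omega)
      have hcard : (Finset.univ.filter fun r => ρ i a ≤ ρ i r).card = 3 - l i := by
        have : (Finset.univ.filter fun r => ρ i a ≤ ρ i r) =
            (Finset.Ici (ρ i a)).map (ρ i).symm.toEmbedding := by
          ext r
          simp
        rw [this, Finset.card_map, Fin.card_Ici, hal]
      obtain ⟨R, haR, hR, hRc⟩ := Finset.exists_subsuperset_card_eq (s := {a})
        (t := Finset.univ.filter fun r => ρ i a ≤ ρ i r) (n := w i + 1) (by simp) (by simp)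
        (by rw [hcard]; omega)
      exact ⟨a, R, fun _ => ⟨ha, hal, haR (Finset.mem_singleton_self a),
        fun r hr => (Finset.mem_filter.mp (hR hr)).2, hRc⟩⟩
    · exact ⟨0, ∅, fun h => absurd h hi⟩
  choose a R hrows using hrows
  set rows : Finset (σ ×ₗ Fin 3) :=
    Finset.univ.filter fun p => (ofLex p).2 ∈ R (ofLex p).1 with hrows_def
  have hcard : rows.card = Fintype.card (Fin 4 ⊕ₗ σ) := by
    rw [Fintype.card_lex, Fintype.card_sum, Fintype.card_fin, Fintype.card_coe, hrows_def,
      Finset.card_filter, ← (toLex : σ × Fin 3 ≃ _).sum_comp, Fintype.sum_prod_type]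
    have : ∀ i : σ, ∑ r : Fin 3, (if (ofLex (toLex (i, r))).2 ∈ R (ofLex (toLex (i, r))).1
        then 1 else 0) = w i + 1 := by
      intro i
      rw [← (hrows i i.2).2.2.2.2, ← Finset.card_filter]
      congr 1
      ext r
      exact Finset.mem_filter.trans (and_iff_right (Finset.mem_univ r))
    rw [Finset.sum_congr rfl fun i _ => this i, Finset.sum_coe_sort σ fun i => w i + 1,
      Finset.sum_add_distrib, hσw]
    simp
  set e : (Fin 4 ⊕ₗ σ) ↪o (σ ×ₗ Fin 3) :=
    (Fintype.orderIsoFinOfCardEq _ rfl).symm.toOrderEmbedding.trans (rows.orderEmbOfFin hcard)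
  have he : ∀ p, p ∈ Set.range e ↔ (ofLex p).2 ∈ R (ofLex p).1 := by
    intro p
    have h1 : p ∈ Set.range (rows.orderEmbOfFin hcard) ↔ (ofLex p).2 ∈ R (ofLex p).1 := by
      rw [Finset.range_orderEmbOfFin]
      simp [hrows_def]
    rw [← h1]
    constructor
    · rintro ⟨c, rfl⟩
      exact ⟨_, rfl⟩
    · rintro ⟨c, rfl⟩
      exact ⟨Fintype.orderIsoFinOfCardEq _ rfl c, congrArg (rows.orderEmbOfFin hcard)
        ((Fintype.orderIsoFinOfCardEq _ rfl).symm_apply_apply c)⟩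
  set f := ((cameraMatrix A σ).submatrix e id).det with hf
  have hfm : f ∈ maximalMinors A σ := ⟨e, rfl⟩
  have hcoeff : f.coeff (transversalExponent σ a) ≠ 0 :=
    coeff_det_ne_zero hA e a fun i => (he _).mpr (hrows i i.2).2.2.1
  have hdeg : m.degree f = transversalExponent σ a := by
    apply m.toSyn.injective
    refine le_antisymm ?_ (m.le_degree (mem_support_iff.mpr hcoeff))
    rw [m.degree_le_iff]
    intro d' hd'
    obtain ⟨s, rfl⟩ := exists_eq_transversalExponent
      (isMultihomogeneous_of_mem_maximalMinors hfm (mem_support_iff.mp hd'))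
    rw [transversalExponent, transversalExponent, map_sum, map_sum]
    refine Finset.sum_le_sum fun i hi => hρ _ _ _ ((hrows i hi).2.2.2.1 _ ?_)
    by_contra hsi
    exact mem_support_iff.mp hd' (coeff_det_eq_zero A e s ⟨i, hi⟩ fun h => hsi ((he _).mp h))
  refine ⟨f, ⟨σ, hσ2, hσ4, hfm⟩, fun h => hcoeff (by rw [h, coeff_zero]), ?_, ?_⟩
  · rw [hdeg]
    intro v
    have := transversalExponent_apply σ a (ofLex v).1 (ofLex v).2
    change transversalExponent σ a v = _ at this
    rw [this]
    split_ifs with h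
    · have hv := (hrows _ h.1).1
      rw [← h.2] at hv
      exact Nat.one_le_iff_ne_zero.mpr hv
    · exact Nat.zero_le _
  · rw [hdeg]
    rintro ⟨l', -, hl1, hl3⟩
    have h1 : ∑ i ∈ σ, w i ≤ ∑ i ∈ σ, (2 - l' i) := by
      refine Finset.sum_le_sum fun i hi => (hw i).trans (Nat.sub_le_sub_left ?_ 2)
      rw [← (hrows i hi).2.1]
      refine (hl1 (a i) i ?_).1
      rw [transversalExponent_apply]
      simp [hi]
    have h2 := Finset.sum_le_sum_of_subset (f := fun i => 2 - l' i) (Finset.subset_univ σ)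
    omega

/-! ### Gröbner bases from independent standard monomials -/

/-- Let `P` be a property of monomials that passes to divisors, and suppose that a polynomial of `I`
that only involves monomials with `P` is zero. If every monomial without `P` is divisible by the
leading monomial of an element of `G ⊆ I` whose leading monomial lacks `P`, then so is the leading
monomial of every nonzero element of `I`. -/
theorem exists_degree_le_of_mem {τ : Type*} {m : MonomialOrder τ} {G : Set (MvPolynomial τ K)}
    {I : Ideal (MvPolynomial τ K)} {P : (τ →₀ ℕ) → Prop} (hG : G ⊆ I)
    (hI : ∀ f ∈ I, (∀ d ∈ f.support, P d) → f = 0)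
    (hP : ∀ d, ¬ P d → ∃ g ∈ G, g ≠ 0 ∧ m.degree g ≤ d ∧ ¬ P (m.degree g))
    {f : MvPolynomial τ K} (hf : f ∈ I) (hf0 : f ≠ 0) :
    ∃ g ∈ G, g ≠ 0 ∧ m.degree g ≤ m.degree f ∧ ¬ P (m.degree g) := by
  set B : Set (MvPolynomial τ K) := {g | g ∈ G ∧ g ≠ 0 ∧ ¬ P (m.degree g)} with hB
  obtain ⟨c, r, hfr, hdeg, hr⟩ := m.div_set (B := B)
    (fun b hb => isUnit_iff_ne_zero.mpr (m.leadingCoeff_ne_zero_iff.mpr hb.2.1)) f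
  have hlin : Finsupp.linearCombination _ (fun b : B => (b : MvPolynomial τ K)) c ∈ I := by
    rw [Finsupp.linearCombination_apply]
    exact I.sum_mem fun b _ => I.mul_mem_left _ (hG b.2.1)
  have hr0 : r = 0 := by
    refine hI r ?_ fun d hd => ?_
    · rw [eq_sub_of_add_eq' hfr.symm]
      exact I.sub_mem hf hlin
    · by_contra hPd
      obtain ⟨g, hg, hg0, hgd, hPg⟩ := hP d hPd
      exact hr d hd g ⟨hg, hg0, hPg⟩ hgd
  rw [hr0, add_zero, Finsupp.linearCombination_apply, Finsupp.sum] at hfr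
  -- the leading monomial of `f` occurs in one of the summands `c b * b`
  have hlead := m.coeff_degree_ne_zero_iff.mpr hf0
  conv at hlead => lhs; arg 2; rw [hfr]
  rw [coeff_sum] at hlead
  obtain ⟨b, -, hb⟩ := Finset.exists_ne_zero_of_sum_ne_zero hlead
  rw [smul_eq_mul, mul_comm] at hb
  have hne : (b : MvPolynomial τ K) * c b ≠ 0 := fun h => hb (by rw [h, coeff_zero])
  have heq : m.degree ((b : MvPolynomial τ K) * c b) = m.degree f :=
    m.toSyn.injective (le_antisymm (hdeg b) (m.le_degree (mem_support_iff.mpr hb)))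
  refine ⟨b, b.2.1, b.2.2.1, ?_, b.2.2.2⟩
  rw [← heq, m.degree_mul' hne]
  exact le_self_add

theorem monomial_mem_span_leadingTerm {τ : Type*} {m : MonomialOrder τ}
    {g : MvPolynomial τ K} (hg : g ≠ 0) {d : τ →₀ ℕ} (h : m.degree g ≤ d) (c : K) :
    monomial d c ∈ Ideal.span {m.leadingTerm g} := by
  rw [Ideal.mem_span_singleton]
  refine ⟨monomial (d - m.degree g) (c / m.leadingCoeff g), ?_⟩
  rw [MonomialOrder.leadingTerm, monomial_mul, add_tsub_cancel_of_le h,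
    mul_div_cancel₀ _ (m.leadingCoeff_ne_zero_iff.mpr hg)]

/-! ### The ideal `M_n` -/

theorem sum_single_apply (s : Finset (Var n)) (v : Var n) :
    (∑ w ∈ s, Finsupp.single w 1 : Var n →₀ ℕ) v = if v ∈ s then 1 else 0 := by
  classical
  simp [Finsupp.finsetSum_apply, Finsupp.single_apply]

theorem prod_X_eq_monomial (s : Finset (Var n)) :
    ∏ v ∈ s, (X v : MvPolynomial (Var n) K) = monomial (∑ v ∈ s, Finsupp.single v 1) 1 := by
  rw [monomial_sum_one]
  rfl

theorem prod_X_dvd_monomial {s : Finset (Var n)} {d : Var n →₀ ℕ} (h : ∀ v ∈ s, d v ≠ 0) :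
    ∏ v ∈ s, (X v : MvPolynomial (Var n) K) ∣ monomial d 1 := by
  classical
  rw [prod_X_eq_monomial, monomial_one_dvd_monomial_one]
  intro v
  rw [sum_single_apply]
  split_ifs with hv
  · exact Nat.one_le_iff_ne_zero.mpr (h v hv)
  · exact Nat.zero_le _

theorem coord_mul_coord {i j : Fin n} (h : i ≠ j) :
    coord K 0 i * coord K 0 j = ∏ v ∈ {toLex (0, i), toLex (0, j)}, X v := by
  rw [Finset.prod_pair (by simp [h])]
  rfl

theorem coord_mul_coord_mul_coord {i j k : Fin n} (h : [i, j, k].Nodup) :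
    coord K 0 i * coord K 1 j * coord K 1 k =
      ∏ v ∈ {toLex (0, i), toLex (1, j), toLex (1, k)}, X v := by
  rw [Finset.prod_insert (by simp), Finset.prod_pair (by simp_all),
    ← mul_assoc]
  rfl

theorem coord_mul_coord_mul_coord_mul_coord {i j k l : Fin n} (h : [i, j, k, l].Nodup) :
    coord K 1 i * coord K 1 j * coord K 1 k * coord K 1 l =
      ∏ v ∈ {toLex (1, i), toLex (1, j), toLex (1, k), toLex (1, l)}, X v := by
  rw [Finset.prod_insert (by simp_all), Finset.prod_insert (by simp_all),
    Finset.prod_pair (by simp_all), ← mul_assoc, ← mul_assoc]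
  rfl

/-- The generators of `M_n` are the minimal monomials that are not standard for the lexicographic
order. -/
theorem monomial_mem_monomialIdealM {d : Var n →₀ ℕ}
    (hd : ¬ IsStandard (fun _ => Equiv.refl _) (fun _ => 2) d) :
    (monomial d 1 : MvPolynomial (Var n) K) ∈ monomialIdealM K n := by
  classical
  -- the blocks in which `x_i` divides `d`, and the other blocks in which `y_i` divides `d`
  set X' : Finset (Fin n) := Finset.univ.filter fun i => d (toLex (0, i)) ≠ 0 with hX
  set Y' : Finset (Fin n) :=
    Finset.univ.filter fun i => d (toLex (0, i)) = 0 ∧ d (toLex (1, i)) ≠ 0 with hY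
  have hXm : ∀ i ∈ X', d (toLex (0, i)) ≠ 0 := fun i hi => (Finset.mem_filter.mp hi).2
  have hYm : ∀ i ∈ Y', d (toLex (0, i)) = 0 ∧ d (toLex (1, i)) ≠ 0 :=
    fun i hi => (Finset.mem_filter.mp hi).2
  have hcard : 4 ≤ 2 * X'.card + Y'.card := by
    by_contra! h
    refine hd ⟨fun i => if d (toLex (0, i)) ≠ 0 then 0 else
      if d (toLex (1, i)) ≠ 0 then 1 else 2, fun i => ?_, fun r i hr => ⟨?_, ?_⟩, ?_⟩
    · dsimp only
      split_ifs <;> simp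
    · fin_cases r
      · simp_all
      · simp_all
        split_ifs <;> simp
      · simp
        split_ifs <;> simp
    · exact Nat.le_of_lt_succ r.2
    · have : ∀ i, 2 - (if d (toLex (0, i)) ≠ 0 then 0 else
          if d (toLex (1, i)) ≠ 0 then 1 else 2) = 2 * (if d (toLex (0, i)) ≠ 0 then 1 else 0) +
            (if d (toLex (0, i)) = 0 ∧ d (toLex (1, i)) ≠ 0 then 1 else 0) := by
        intro i
        by_cases h0 : d (toLex (0, i)) = 0 <;> by_cases h1 : d (toLex (1, i)) = 0 <;>
          simp [h0, h1]
      rw [Finset.sum_congr rfl fun i _ => this i, Finset.sum_add_distrib, ← Finset.mul_sum,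
        ← Finset.card_filter, ← Finset.card_filter]
      convert Nat.le_of_lt_succ h
  rcases Nat.lt_or_ge 1 X'.card with h2 | h2
  · obtain ⟨i, hi, j, hj, hij⟩ := Finset.one_lt_card.mp h2
    refine Ideal.mem_of_dvd _ ?_ (Ideal.subset_span (Or.inl (Or.inl ⟨i, j, hij, rfl⟩)))
    rw [coord_mul_coord hij]
    exact prod_X_dvd_monomial (by simp [hXm i hi, hXm j hj])
  rcases Nat.eq_zero_or_pos X'.card with h0 | h1
  · obtain ⟨T, hT, hT4⟩ := Finset.exists_subset_card_eq (show 4 ≤ Y'.card by omega)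
    set t := (Finset.equivFinOfCardEq hT4).symm
    have ht : ∀ a, d (toLex (1, (t a : Fin n))) ≠ 0 := fun a => (hYm _ (hT (t a).2)).2
    have hnd : [(t 0 : Fin n), t 1, t 2, t 3].Nodup := by
      simp [t.injective.eq_iff]
    refine Ideal.mem_of_dvd _ ?_
      (Ideal.subset_span (Or.inr ⟨t 0, t 1, t 2, t 3, hnd, rfl⟩))
    rw [coord_mul_coord_mul_coord_mul_coord hnd]
    exact prod_X_dvd_monomial (by simp [ht])
  · obtain ⟨i, hi⟩ := Finset.card_pos.mp h1
    obtain ⟨j, hj, k, hk, hjk⟩ := Finset.one_lt_card.mp (show 1 < Y'.card by omega)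
    have hij : i ≠ j := fun h => hXm i hi (h ▸ (hYm j hj).1)
    have hik : i ≠ k := fun h => hXm i hi (h ▸ (hYm k hk).1)
    have hnd : [i, j, k].Nodup := by simp [hij, hik, hjk]
    refine Ideal.mem_of_dvd _ ?_ (Ideal.subset_span (Or.inl (Or.inr ⟨i, j, k, hnd, rfl⟩)))
    rw [coord_mul_coord_mul_coord hnd]
    exact prod_X_dvd_monomial (by simp [hXm i hi, (hYm j hj).2, (hYm k hk).2])

/-- A squarefree monomial is not standard if the variables in the blocks of `T` have total
weight at least `4`, where `x_i` has weight `2` and `y_i` has weight `1`. -/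
theorem not_isStandard_sum_single {s : Finset (Var n)} (T : Finset (Fin n)) (ρ : Fin n → Fin 3)
    (hs : ∀ i ∈ T, toLex (ρ i, i) ∈ s) (hT : 4 ≤ ∑ i ∈ T, (2 - (ρ i : ℕ))) :
    ¬ IsStandard (fun _ => Equiv.refl _) (fun _ => 2) (∑ v ∈ s, Finsupp.single v 1) := by
  rintro ⟨l, -, hl, hl3⟩
  have h1 : ∑ i ∈ T, (2 - (ρ i : ℕ)) ≤ ∑ i ∈ T, (2 - l i) :=
    Finset.sum_le_sum fun i hi => Nat.sub_le_sub_left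
      (hl (ρ i) i (by rw [sum_single_apply, if_pos (hs i hi)]; exact one_ne_zero)).1 2
  have h2 := Finset.sum_le_sum_of_subset (f := fun i => 2 - l i) (Finset.subset_univ T)
  omega

/-- The generators of `M_n` are not standard. -/
theorem monomialIdealM_le {I : Ideal (MvPolynomial (Var n) K)}
    (hI : ∀ d, ¬ IsStandard (fun _ => Equiv.refl _) (fun _ => 2) d →
      (monomial d 1 : MvPolynomial (Var n) K) ∈ I) : monomialIdealM K n ≤ I := by
  classical
  refine Ideal.span_le.mpr ?_
  rintro f ((⟨i, j, hij, rfl⟩ | ⟨i, j, k, hnd, rfl⟩) | ⟨i, j, k, l, hnd, rfl⟩)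
  · rw [coord_mul_coord hij, prod_X_eq_monomial]
    refine hI _ (not_isStandard_sum_single {i, j} (fun _ => 0) (by simp) ?_)
    simp [Finset.sum_pair hij]
  · rw [coord_mul_coord_mul_coord hnd, prod_X_eq_monomial]
    simp only [List.nodup_cons, List.mem_cons, List.not_mem_nil, or_false, not_or] at hnd
    refine hI _ (not_isStandard_sum_single {i, j, k} (fun a => if a = i then 0 else 1) ?_ ?_)
    · simp [Ne.symm hnd.1.1, Ne.symm hnd.1.2]
    · rw [Finset.sum_insert (by simp [hnd.1]), Finset.sum_pair hnd.2.1]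
      simp [Ne.symm hnd.1.1, Ne.symm hnd.1.2]
  · rw [coord_mul_coord_mul_coord_mul_coord hnd, prod_X_eq_monomial]
    refine hI _ (not_isStandard_sum_single {i, j, k, l} (fun _ => 1) (by simp) ?_)
    have hcard : ({i, j, k, l} : Finset (Fin n)).card = 4 := by
      simpa using List.toFinset_card_of_nodup hnd
    simp [hcard]

/-! ### The Gröbner basis -/

/-- The leading monomials of the multiview ideal are not standard, and are divisible by leading
monomials of minors. -/
theorem exists_minor_degree_le [Infinite K] (hn : 2 ≤ n) {A : Fin n → Matrix (Fin 3) (Fin 4) K}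
    (hA : IsGenericConfiguration A) {m : MonomialOrder (Var n)} {ρ : Fin n → Equiv.Perm (Fin 3)}
    (hρ : SortsBlocks m ρ) {f : MvPolynomial (Var n) K} (hf : f ∈ multiviewIdeal A)
    (hf0 : f ≠ 0) :
    ∃ g ∈ {f | ∃ σ : Finset (Fin n), 2 ≤ σ.card ∧ σ.card ≤ 4 ∧ f ∈ maximalMinors A σ}, g ≠ 0 ∧
      m.degree g ≤ m.degree f ∧ ¬ IsStandard ρ (fun _ => 2) (m.degree g) :=
  exists_degree_le_of_mem (I := multiviewIdeal A)
    (by rintro _ ⟨_, -, -, hg⟩; exact mem_multiviewIdeal_of_mem_maximalMinors hg)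
    (fun _ hf => eq_zero_of_mem_multiviewIdeal_of_isStandard hn hA ρ hf)
    (fun _ hd => exists_degree_le_of_not_isStandard hA hρ hd) hf hf0

theorem isUniversalGroebnerBasis_minors [Infinite K] (hn : 2 ≤ n)
    {A : Fin n → Matrix (Fin 3) (Fin 4) K} (hA : IsGenericConfiguration A) :
    IsUniversalGroebnerBasis
      {f | ∃ σ : Finset (Fin n), 2 ≤ σ.card ∧ σ.card ≤ 4 ∧ f ∈ maximalMinors A σ}
      (multiviewIdeal A) := by
  intro m
  have hsub : {f | ∃ σ : Finset (Fin n), 2 ≤ σ.card ∧ σ.card ≤ 4 ∧ f ∈ maximalMinors A σ} ⊆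
      (multiviewIdeal A : Set (MvPolynomial (Var n) K)) :=
    fun _ ⟨_, _, _, hg⟩ => mem_multiviewIdeal_of_mem_maximalMinors hg
  refine ⟨?_, hsub, le_antisymm (Ideal.span_mono (Set.image_mono hsub)) (Ideal.span_le.mpr ?_)⟩
  · refine (Set.finite_iUnion fun σ : Finset (Fin n) => ?_ :
      (⋃ σ, maximalMinors A σ).Finite).subset ?_
    · have : Finite ((Fin 4 ⊕ₗ σ) ↪o (σ ×ₗ Fin 3)) :=
        Finite.of_injective _ (DFunLike.coe_injective (F := (Fin 4 ⊕ₗ σ) ↪o (σ ×ₗ Fin 3)))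
      exact Set.finite_range _
    · rintro f ⟨σ, -, -, hf⟩
      exact Set.mem_iUnion.mpr ⟨σ, hf⟩
  · rintro _ ⟨f, hf, rfl⟩
    rcases eq_or_ne f 0 with rfl | hf0
    · rw [m.leadingTerm_zero]
      exact Ideal.zero_mem _
    · obtain ⟨ρ, hρ⟩ := exists_sortsBlocks m
      obtain ⟨g, hg, hg0, hle, -⟩ := exists_minor_degree_le hn hA hρ hf hf0
      exact Ideal.span_mono (Set.singleton_subset_iff.mpr (Set.mem_image_of_mem _ hg))
        (monomial_mem_span_leadingTerm hg0 hle _)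

theorem initialIdeal_lex_eq_monomialIdealM [Infinite K] (hn : 2 ≤ n)
    {A : Fin n → Matrix (Fin 3) (Fin 4) K} (hA : IsGenericConfiguration A) :
    initialIdeal MonomialOrder.lex (multiviewIdeal A) = monomialIdealM K n := by
  refine le_antisymm (Ideal.span_le.mpr ?_) (monomialIdealM_le fun d hd => ?_)
  · rintro _ ⟨f, hf, rfl⟩
    rcases eq_or_ne f 0 with rfl | hf0
    · rw [MonomialOrder.leadingTerm_zero]
      exact Ideal.zero_mem _
    · obtain ⟨g, -, -, hle, hns⟩ := exists_minor_degree_le hn hA sortsBlocks_lex hf hf0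
      rw [MonomialOrder.leadingTerm, ← mul_one (MonomialOrder.leadingCoeff _ f), ← C_mul_monomial]
      exact Ideal.mul_mem_left _ _ (monomial_mem_monomialIdealM fun h => hns (h.mono hle))
  · obtain ⟨g, ⟨σ, -, -, hg⟩, hg0, hle, -⟩ :=
      exists_degree_le_of_not_isStandard hA sortsBlocks_lex hd
    exact Ideal.span_mono (Set.singleton_subset_iff.mpr
      (Set.mem_image_of_mem _ (mem_multiviewIdeal_of_mem_maximalMinors hg)))
      (monomial_mem_span_leadingTerm hg0 hle _)

end Multiview

theorem theorem2p1 {K : Type*} [Field K] [IsAlgClosed K] {n : ℕ} (hn : 2 ≤ n)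
    (A : Fin n → Matrix (Fin 3) (Fin 4) K) (hrank : ∀ i, (A i).rank = 3)
    (hA : Multiview.IsGenericConfiguration A) :
    Multiview.IsUniversalGroebnerBasis
        {f | ∃ σ : Finset (Fin n), 2 ≤ σ.card ∧ σ.card ≤ 4 ∧ f ∈ Multiview.maximalMinors A σ}
        (Multiview.multiviewIdeal A) ∧
      (∀ σ : Finset (Fin n), 2 ≤ σ.card → σ.card ≤ 4 → ∀ f ∈ Multiview.maximalMinors A σ,
        Multiview.IsMultihomogeneous (fun i => if i ∈ σ then 1 else 0) f ∧
          f.IsHomogeneous σ.card) ∧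
      Multiview.initialIdeal MonomialOrder.lex (Multiview.multiviewIdeal A) =
        Multiview.monomialIdealM K n := by
  have : Infinite K := IsAlgClosed.instInfinite
  refine ⟨Multiview.isUniversalGroebnerBasis_minors hn hA, fun σ _ _ f hf => ?_,
    Multiview.initialIdeal_lex_eq_monomialIdealM hn hA⟩
  have h := Multiview.isMultihomogeneous_of_mem_maximalMinors hf
  exact ⟨h, by simpa using h.isHomogeneous⟩
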